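/- **Lemma.** Let $\sigma$ be a finite dictionary, i.e. a finite set of relation symbols, each with a finite arity. A structure $S$ over $\sigma$ is a set $V(S)$ with a relation $R^S\subseteq V(S)^k$ for every $k$-ary $R\in\sigma$; write $R(x)$ if $x\in R^S$. The *Gaifman graph* $G_S$ has vertex set $V(S)$; distinct $a,b$ are adjacent if there are a $k$-ary $R\in\sigma$ and a tuple $x=(x_1,\dots,x_k)$ with $R(x)$ such that $a,b\in\{x_1,\dots,x_k\}$. The *incidence graph* $G^i_S$ is the bipartite undirected graph with edges colored by $\sigma\cup\{c\}$, where $c\notin\sigma$, whose vertices are the elements of $V(S)$ and, for each $k$-ary $R\in\sigma$ and each tuple $x\in V(S)^k$ with $R(x)$, two further vertices $v_{R,x}$ and $v'_{R,x}$; for each such $R$ and $x$ it has an edge $v_{R,x}v'_{R,x}$ of color $R$ and edges $x_jv_{R,x}$ of color $c$ for $1\le j\le k$, and it has no other edges. All graphs are simple. A graph $H$ is a *minor of depth $r$* of a graph $G$ if it can be obtained from a subgraph of $G$ by contracting vertex-disjoint subgraphs of radius at most $r$ into single vertices and suppressing the arising loops and parallel edges. Let $\nabla_r(G)$ be the supremum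 of $|E(H)|/|V(H)|$ over the finite nonempty minors $H$ of depth $r$ of $G$. A class $\mathcal G$ of graphs has *bounded expansion* if there is a function $f:\mathbb N\to\mathbb R_{\ge 0}$ with $\nabla_r(G)\le f(r)$ for all $G\in\mathcal G$ and $r\in\mathbb N$; it is *nowhere dense* if there is a function $f:\mathbb N\to\mathbb N$ such that for all $G\in\mathcal G$ and $r\in\mathbb N$ every finite minor of depth $r$ of $G$ has clique number at most $f(r)$. For a class of edge-colored graphs, these notions refer to the graphs with the colors forgotten. A class $\mathcal S$ of structures over $\sigma$ has bounded expansion (is nowhere dense) if the class $\{G_S : S\in\mathcal S\}$ has bounded expansion (is nowhere dense). Let $\mathcal S$ be any class of structures over $\sigma$. If $\mathcal S$ has bounded expansion, then the class $\mathcal S^i=\{G^i_S : S\in\mathcal S\}$ has bounded expansion. If $\mathcal S$ is nowhere dense, then $\mathcal S^i$ is nowhere dense. -/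

import Mathlib

open scoped NNReal ENNReal

universe u v w

namespace SparseClasses

section Graphs

/-- `H` is a minor of depth `r` of `G`: the vertices of `H` are obtained by contracting the pairwise
disjoint sets `B w`, each of which spans a subgraph of radius at most `r` in `G` (so it is nonempty
and connected), and every edge of `H` comes from an edge of `G`. Since edges and vertices of `G` may
be deleted before the contraction, `H` need not contain all the edges that arise. -/
def IsMinorOfDepth {V : Type u} {W : Type v} (r : ℕ) (H : SimpleGraph W) (G : SimpleGraph V) :
    Prop :=
  ∃ B : W → Set V,
    (∀ w w', w ≠ w' → Disjoint (B w) (B w')) ∧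
    (∀ w, (G.induce (B w)).radius ≤ (r : ℕ∞)) ∧
    (∀ w w', H.Adj w w' → ∃ x ∈ B w, ∃ y ∈ B w', G.Adj x y)

/-- The greatest reduced average density `∇_r(G)`: the supremum of `|E(H)| / |V(H)|` over the (finite)
minors `H` of depth `r` of `G`. It is a maximum when `G` is finite. -/
noncomputable def nabla {V : Type u} (r : ℕ) (G : SimpleGraph V) : ℝ≥0∞ :=
  ⨆ (n : ℕ) (H : SimpleGraph (Fin n)) (_ : IsMinorOfDepth r H G),
    (H.edgeSet.ncard : ℝ≥0∞) / (n : ℝ≥0∞)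

/-- A class of graphs. -/
abbrev GraphClass : Type (u + 1) := Set (Σ V : Type u, SimpleGraph V)

/-- `G` has expansion bounded by `f`. -/
def ExpansionBoundedBy {V : Type u} (G : SimpleGraph V) (f : ℕ → ℝ≥0) : Prop :=
  ∀ r : ℕ, nabla r G ≤ (f r : ℝ≥0∞)

/-- A class of graphs has bounded expansion. -/
def GraphClass.HasBoundedExpansion (𝒢 : GraphClass.{u}) : Prop :=
  ∃ f : ℕ → ℝ≥0, ∀ G ∈ 𝒢, ExpansionBoundedBy G.2 f

/-- A class of graphs is nowhere dense: the clique number of every (finite) minor of depth `r` of a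
graph of the class is at most `f r`. -/
def GraphClass.IsNowhereDense (𝒢 : GraphClass.{u}) : Prop :=
  ∃ f : ℕ → ℕ, ∀ G ∈ 𝒢, ∀ (r n : ℕ) (H : SimpleGraph (Fin n)),
    IsMinorOfDepth r H G.2 → H.cliqueNum ≤ f r

/-- A graph on the vertex set `V` with its edges colored by elements of `C`. -/
structure EdgeColoredGraph (V : Type u) (C : Type w) where
  graph : SimpleGraph V
  color : graph.EdgeLabeling C

/-- A class of graphs with edges colored by elements of `C`. -/
abbrev EdgeColoredGraphClass (C : Type w) : Type (max (u + 1) w) :=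
  Set (Σ V : Type u, EdgeColoredGraph V C)

/-- The class of the graphs of a class of edge-colored graphs, with the colors forgotten. -/
def EdgeColoredGraphClass.forgetColors {C : Type w} (𝒢 : EdgeColoredGraphClass.{u, w} C) :
    GraphClass.{u} :=
  (fun G => ⟨G.1, G.2.graph⟩) '' 𝒢

/-- A class of edge-colored graphs has bounded expansion. -/
def EdgeColoredGraphClass.HasBoundedExpansion {C : Type w}
    (𝒢 : EdgeColoredGraphClass.{u, w} C) : Prop :=
  GraphClass.HasBoundedExpansion 𝒢.forgetColors

/-- A class of edge-colored graphs is nowhere dense. -/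
def EdgeColoredGraphClass.IsNowhereDense {C : Type w}
    (𝒢 : EdgeColoredGraphClass.{u, w} C) : Prop :=
  GraphClass.IsNowhereDense 𝒢.forgetColors

end Graphs

section Structures

open CategoryTheory

/-- The Gaifman graph of a structure: distinct `a` and `b` are adjacent if both occur in a common
tuple of a relation. -/
def gaifmanGraph (L : FirstOrder.Language.{v, w}) (M : Type u) [L.Structure M] : SimpleGraph M where
  Adj a b := a ≠ b ∧ ∃ (k : ℕ) (R : L.Relations k) (x : Fin k → M),
    FirstOrder.Language.Structure.RelMap R x ∧ a ∈ Set.range x ∧ b ∈ Set.range x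
  symm := ⟨fun _ _ ⟨hab, k, R, x, hR, ha, hb⟩ => ⟨hab.symm, k, R, x, hR, hb, ha⟩⟩
  loopless := ⟨fun _ h => h.1 rfl⟩

/-- A relation symbol together with a tuple that satisfies it. -/
structure RelTuple (L : FirstOrder.Language.{v, w}) (M : Type u) [L.Structure M] where
  arity : ℕ
  symbol : L.Relations arity
  entries : Fin arity → M
  holds : FirstOrder.Language.Structure.RelMap symbol entries

/-- The vertices of the incidence graph: the elements of the structure, and two vertices
`v_{R,x}` and `v'_{R,x}` for every `R` and `x` such that `R(x)` holds. -/
inductive IncidenceVertex (L : FirstOrder.Language.{v, w}) (M : Type u) [L.Structure M] : Type (max u w)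
  | elem (a : M) : IncidenceVertex L M
  | vtx (t : RelTuple L M) : IncidenceVertex L M
  | vtx' (t : RelTuple L M) : IncidenceVertex L M

/-- Adjacency in the incidence graph. -/
def IncidenceAdj {L : FirstOrder.Language.{v, w}} {M : Type u} [L.Structure M] :
    IncidenceVertex L M → IncidenceVertex L M → Prop
  | .elem a, .vtx t => a ∈ Set.range t.entries
  | .vtx t, .elem a => a ∈ Set.range t.entries
  | .vtx t, .vtx' t' => t = t'
  | .vtx' t', .vtx t => t = t'
  | _, _ => False

/-- The colors of the edges of the incidence graph: the relation symbols, and the additional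
color `none`. -/
abbrev IncidenceColor (L : FirstOrder.Language.{v, w}) : Type w := Option (Σ k, L.Relations k)

/-- The color of an edge of the incidence graph, in terms of its ends: the edge `v_{R,x} v'_{R,x}`
has color `R`, and the edges `x_i v_{R,x}` have the additional color. The values at pairs that are
not edges are irrelevant. -/
def incidenceColor {L : FirstOrder.Language.{v, w}} {M : Type u} [L.Structure M] :
    IncidenceVertex L M → IncidenceVertex L M → IncidenceColor L
  | .vtx t, .vtx' _ => some ⟨t.arity, t.symbol⟩
  | .vtx' _, .vtx t => some ⟨t.arity, t.symbol⟩
  | _, _ => none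

/-- The edge-colored incidence graph of a structure. -/
def incidenceGraph (L : FirstOrder.Language.{v, w}) (M : Type u) [L.Structure M] :
    EdgeColoredGraph (IncidenceVertex L M) (IncidenceColor L) where
  graph :=
    { Adj := IncidenceAdj
      symm := ⟨fun a b h => by cases a <;> cases b <;> exact h⟩
      loopless := ⟨fun a h => by cases a <;> exact h⟩ }
  color := SimpleGraph.EdgeLabeling.mk (fun a b _ => incidenceColor a b)
    (fun a b _ => by cases a <;> cases b <;> rfl)

/-- The class of the Gaifman graphs of the structures of a class. -/
def gaifmanClass {L : FirstOrder.Language.{v, w}} (𝒮 : Set (Bundled.{u} L.Structure)) : GraphClass.{u} :=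
  (fun S : Bundled.{u} L.Structure => ⟨S, gaifmanGraph L S⟩) '' 𝒮

/-- The class of the edge-colored incidence graphs of the structures of a class. -/
def incidenceClass {L : FirstOrder.Language.{v, w}} (𝒮 : Set (Bundled.{u} L.Structure)) :
    EdgeColoredGraphClass.{max u w, w} (IncidenceColor L) :=
  (fun S : Bundled.{u} L.Structure => ⟨IncidenceVertex L S, incidenceGraph L S⟩) '' 𝒮

/-- A class of structures has bounded expansion if the class of their Gaifman graphs has. -/
def StructuresHaveBoundedExpansion {L : FirstOrder.Language.{v, w}} (𝒮 : Set (Bundled.{u} L.Structure)) :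
    Prop :=
  (gaifmanClass 𝒮).HasBoundedExpansion

/-- A class of structures is nowhere dense if the class of their Gaifman graphs is. -/
def StructuresAreNowhereDense {L : FirstOrder.Language.{v, w}} (𝒮 : Set (Bundled.{u} L.Structure)) : Prop :=
  (gaifmanClass 𝒮).IsNowhereDense

end Structures

end SparseClasses

/-! Let `B w` be the branch sets of a depth-`r` minor `H` of the incidence graph, and let `A`
consist of those `w` whose `B w` contains an element of the structure.

For `w` in `A`, keep only the elements of `B w`. An incidence walk through a tuple vertex becomes a
Gaifman edge, so these traces have radius at most `2 * r` and realize all edges of `H` inside `A`: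
`H.induce A` is a minor of the Gaifman graph.

For `w` outside `A`, connectedness confines `B w` to the pair `v_{R,x}`, `v'_{R,x}` of one tuple, so
`w` has at most `K + 2` neighbours, where `K` bounds the arities
(`exists_induce_isMinorOfDepth_gaifmanGraph`). Such vertices add at most `K + 2` to the density, and
a clique containing one has at most `K + 3` vertices. -/

namespace SparseClasses

/-! ### Finite minors and vertices of small degree -/

section Minors

variable {V : Type u} {W : Type v}

/-- A minor of depth `r` whose vertex set is an arbitrary finite type, not necessarily `Fin n`. -/
theorem IsMinorOfDepth.exists_fin [Fintype W] {r : ℕ} {H : SimpleGraph W} {G : SimpleGraph V}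
    (h : IsMinorOfDepth r H G) :
    ∃ H' : SimpleGraph (Fin (Fintype.card W)), Nonempty (H ≃g H') ∧ IsMinorOfDepth r H' G := by
  obtain ⟨B, hdisj, hrad, hadj⟩ := h
  let e := Fintype.equivFin W
  refine ⟨H.comap e.symm, ⟨(SimpleGraph.Iso.comap e.symm H).symm⟩, fun w => B (e.symm w),
    fun w w' hne => hdisj _ _ (e.symm.injective.ne hne), fun w => hrad _,
    fun w w' hw => hadj _ _ hw⟩

theorem IsMinorOfDepth.ncard_edgeSet_le [Fintype W] {r : ℕ} {H : SimpleGraph W}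
    {G : SimpleGraph V} (h : IsMinorOfDepth r H G) :
    (H.edgeSet.ncard : ℝ≥0∞) ≤ nabla r G * Fintype.card W := by
  obtain ⟨H', ⟨e⟩, hH'⟩ := h.exists_fin
  have hcard : H.edgeSet.ncard = H'.edgeSet.ncard := Nat.card_congr e.mapEdgeSet
  rw [hcard]
  -- The denominator can be cleared only if `W` is nonempty; otherwise there are no edges.
  rcases Nat.eq_zero_or_pos (Fintype.card W) with h0 | hpos
  · have : IsEmpty (Fin (Fintype.card W)) := by rw [h0]; infer_instance
    have hempty : H'.edgeSet = ∅ := by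
      rw [SimpleGraph.edgeSet_eq_empty]
      exact Subsingleton.elim _ _
    simp [hempty]
  · have hle : (H'.edgeSet.ncard : ℝ≥0∞) / (Fintype.card W : ℝ≥0∞) ≤ nabla r G :=
      le_iSup_of_le (Fintype.card W) (le_iSup_of_le H' (le_iSup_of_le hH' le_rfl))
    rwa [ENNReal.div_le_iff (by exact_mod_cast hpos.ne') (ENNReal.natCast_ne_top _)] at hle

theorem IsMinorOfDepth.card_le_of_isClique [Fintype W] {r k : ℕ} {H : SimpleGraph W}
    {G : SimpleGraph V} (h : IsMinorOfDepth r H G)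
    (hG : ∀ (n : ℕ) (H : SimpleGraph (Fin n)), IsMinorOfDepth r H G → H.cliqueNum ≤ k)
    {s : Finset W} (hs : H.IsClique s) : s.card ≤ k := by
  obtain ⟨H', ⟨e⟩, hH'⟩ := h.exists_fin
  refine le_trans ?_ (hG _ H' hH')
  have hs' : H'.IsClique (s.map e.toEquiv.toEmbedding) := by
    intro a ha b hb hab
    simp only [Finset.coe_map, Set.mem_image] at ha hb
    obtain ⟨a, ha, rfl⟩ := ha
    obtain ⟨b, hb, rfl⟩ := hb
    exact e.map_adj_iff.2 (hs ha hb fun h => hab (by rw [h]))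
  simpa using hs'.card_le_cliqueNum

open Classical in
/-- If all vertices outside `A` have degree at most `d`, then all but `d |V|` edges are spanned by
`A`. -/
theorem ncard_edgeSet_le_induce_add [Fintype W] (H : SimpleGraph W) (A : Set W) (d : ℕ)
    (hA : ∀ w, w ∉ A → (H.neighborSet w).ncard ≤ d) :
    H.edgeSet.ncard ≤ (H.induce A).edgeSet.ncard + Fintype.card W * d := by
  let E : Finset (Sym2 W) := (H.induce A).edgeFinset.image (Sym2.map Subtype.val)
  -- An edge either has both ends in `A` or is incident to a vertex outside `A`.
  have hsub : H.edgeFinset ⊆ E ∪ Finset.univ.biUnion fun w =>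
      if w ∈ A then ∅ else H.incidenceFinset w := by
    intro e
    induction e using Sym2.ind with
    | _ a b =>
      intro hab
      rw [SimpleGraph.mem_edgeFinset, SimpleGraph.mem_edgeSet] at hab
      by_cases ha : a ∈ A
      · by_cases hb : b ∈ A
        · refine Finset.mem_union_left _ (Finset.mem_image.2 ⟨s(⟨a, ha⟩, ⟨b, hb⟩), ?_, rfl⟩)
          rw [SimpleGraph.mem_edgeFinset]
          exact hab
        · refine Finset.mem_union_right _ (Finset.mem_biUnion.2 ⟨b, Finset.mem_univ _, ?_⟩)
          rw [if_neg hb, SimpleGraph.mem_incidenceFinset]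
          exact ⟨hab, Sym2.mem_mk_right a b⟩
      · refine Finset.mem_union_right _ (Finset.mem_biUnion.2 ⟨a, Finset.mem_univ _, ?_⟩)
        rw [if_neg ha, SimpleGraph.mem_incidenceFinset]
        exact ⟨hab, Sym2.mem_mk_left a b⟩
  have h1 : H.edgeSet.ncard = H.edgeFinset.card := by
    rw [← SimpleGraph.coe_edgeFinset, Set.ncard_coe_finset]
  have h2 : (H.induce A).edgeSet.ncard = (H.induce A).edgeFinset.card := by
    rw [← SimpleGraph.coe_edgeFinset, Set.ncard_coe_finset]
  rw [h1, h2]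
  refine (Finset.card_le_card hsub).trans ((Finset.card_union_le _ _).trans
    (add_le_add Finset.card_image_le (Finset.card_biUnion_le_card_mul _ _ _ fun w _ => ?_)))
  split_ifs with hw
  · simp
  · rw [SimpleGraph.card_incidenceFinset_eq_degree]
    have := hA w hw
    rwa [← SimpleGraph.coe_neighborFinset, Set.ncard_coe_finset] at this

/-- If all vertices outside `A` have degree at most `d`, then a clique lies in `A` or has at most
`d + 1` elements. -/
theorem isClique_subset_or_card_le [Finite W] {H : SimpleGraph W} {A : Set W} {d : ℕ}
    (hA : ∀ w, w ∉ A → (H.neighborSet w).ncard ≤ d) {s : Finset W} (hs : H.IsClique s) :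
    (s : Set W) ⊆ A ∨ s.card ≤ d + 1 := by
  classical
  by_contra! hcon
  obtain ⟨w, hws, hwA⟩ := Set.not_subset.1 hcon.1
  have hsub : ((s.erase w : Finset W) : Set W) ⊆ H.neighborSet w := by
    intro x hx
    rw [Finset.mem_coe, Finset.mem_erase] at hx
    exact hs hws hx.2 hx.1.symm
  have h1 := Set.ncard_le_ncard hsub (Set.toFinite _)
  rw [Set.ncard_coe_finset, Finset.card_erase_of_mem hws] at h1
  have := hA w hwA
  omega

end Minors

/-! ### From the incidence graph to the Gaifman graph -/

section Incidence

variable {L : FirstOrder.Language.{v, w}} {M : Type u} [L.Structure M]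

theorem gaifmanGraph_adj_of_mem {t : RelTuple L M} {a b : M} (ha : a ∈ Set.range t.entries)
    (hb : b ∈ Set.range t.entries) (hab : a ≠ b) : (gaifmanGraph L M).Adj a b :=
  ⟨hab, t.arity, t.symbol, t.entries, t.holds, ha, hb⟩

/-- The element `a` equals the vertex, or occurs in the tuple to which the vertex belongs. -/
def IncidenceVertex.Touches : IncidenceVertex L M → M → Prop
  | .elem b, a => b = a
  | .vtx t, a => a ∈ Set.range t.entries
  | .vtx' t, a => a ∈ Set.range t.entries

/-- Induction along the walk, with `a` as the last element visited: it stays touched while the walk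
remains at the vertices of one tuple. Only a step onto a new element moves `a`, at the cost of at
most one Gaifman edge. -/
theorem edist_induce_le_length {B : Set (IncidenceVertex L M)} {x y : B}
    (p : ((incidenceGraph L M).graph.induce B).Walk x y) (a b : IncidenceVertex.elem ⁻¹' B)
    (hx : x.1.Touches a.1) (hy : y.1 = .elem b.1) :
    ((gaifmanGraph L M).induce (IncidenceVertex.elem ⁻¹' B)).edist a b ≤ p.length := by
  induction p generalizing a with
  | nil =>
    rw [hy] at hx
    have hab : a = b := Subtype.ext (Eq.symm hx)
    simp [hab]
  | @cons x z y hadj p ih =>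
    obtain ⟨x, hxB⟩ := x
    obtain ⟨z, hzB⟩ := z
    have hadj' : IncidenceAdj x z := hadj
    have hle : (p.length : ℕ∞) ≤ (SimpleGraph.Walk.cons hadj p).length := by
      simp
    cases x <;> cases z <;> try exact hadj'.elim
    · refine (ih a ?_ hy).trans hle
      cases hx
      exact hadj'
    -- Here `a` and `c` are entries of the same tuple `t`.
    · rename_i t c
      refine (SimpleGraph.edist_triangle (v := ⟨c, hzB⟩)).trans ?_
      have h1 : ((gaifmanGraph L M).induce (IncidenceVertex.elem ⁻¹' B)).edist a ⟨c, hzB⟩ ≤ 1 := by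
        rw [SimpleGraph.edist_le_one_iff_adj_or_eq]
        by_cases hac : a.1 = c
        · exact Or.inr (Subtype.ext hac)
        · exact Or.inl (gaifmanGraph_adj_of_mem hx hadj' hac)
      refine (add_le_add h1 (ih ⟨c, hzB⟩ rfl hy)).trans ?_
      rw [SimpleGraph.Walk.length_cons, add_comm]
      simp
    · refine (ih a ?_ hy).trans hle
      cases hadj'
      exact hx
    · refine (ih a ?_ hy).trans hle
      cases hadj'
      exact hx

/-- The centre of `B` may be a tuple vertex, so distances are measured from the element `a` by
passing through that centre; this doubles the radius. -/
theorem radius_induce_elem_le {B : Set (IncidenceVertex L M)} {r : ℕ}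
    (hB : ((incidenceGraph L M).graph.induce B).radius ≤ (r : ℕ∞))
    {a : M} (ha : .elem a ∈ B) :
    ((gaifmanGraph L M).induce (IncidenceVertex.elem ⁻¹' B)).radius ≤ ((2 * r : ℕ) : ℕ∞) := by
  set I := (incidenceGraph L M).graph.induce B
  have : Nonempty B := ⟨⟨_, ha⟩⟩
  obtain ⟨c, hc⟩ := I.exists_eccent_eq_radius
  rw [← hc, SimpleGraph.eccent_le_iff] at hB
  refine (SimpleGraph.radius_le_eccent (u := ⟨a, ha⟩)).trans
    ((SimpleGraph.eccent_le_iff _ _).2 fun b => ?_)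
  have hle : I.edist ⟨.elem a, ha⟩ ⟨.elem b.1, b.2⟩ ≤ ((2 * r : ℕ) : ℕ∞) := by
    refine (SimpleGraph.edist_triangle (v := c)).trans ?_
    rw [SimpleGraph.edist_comm]
    refine (add_le_add (hB _) (hB _)).trans ?_
    rw [two_mul, Nat.cast_add]
  obtain ⟨p, hp⟩ := SimpleGraph.exists_walk_of_edist_ne_top
    (ne_top_of_le_ne_top (ENat.natCast_ne_top _) hle)
  rw [← hp] at hle
  exact (edist_induce_le_length p ⟨a, ha⟩ b rfl rfl).trans hle

theorem connected_of_radius_le {V : Type*} {G : SimpleGraph V} {r : ℕ}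
    (h : G.radius ≤ (r : ℕ∞)) : G.Connected := by
  by_contra hG
  rw [SimpleGraph.radius_eq_top_of_not_connected hG, top_le_iff] at h
  exact ENat.natCast_ne_top _ h

/-- A connected set of vertices of the incidence graph that meets the two vertices of a tuple and
contains none of its entries consists of these vertices only. -/
theorem subset_pair_of_connected {B : Set (IncidenceVertex L M)}
    (hB : ((incidenceGraph L M).graph.induce B).Connected) {t : RelTuple L M}
    {x : IncidenceVertex L M} (hx : x ∈ B) (hxt : x = .vtx t ∨ x = .vtx' t)
    (hno : ∀ a ∈ Set.range t.entries, .elem a ∉ B) :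
    ∀ y ∈ B, y = .vtx t ∨ y = .vtx' t := by
  intro y hy
  obtain ⟨p⟩ := hB ⟨x, hx⟩ ⟨y, hy⟩
  suffices ∀ {x y : B} (_ : ((incidenceGraph L M).graph.induce B).Walk x y),
      (x.1 = .vtx t ∨ x.1 = .vtx' t) → (y.1 = .vtx t ∨ y.1 = .vtx' t) from this p hxt
  intro x y p hxt
  induction p with
  | nil => exact hxt
  | @cons x z y hadj p ih =>
    obtain ⟨x, hxB⟩ := x
    obtain ⟨z, hzB⟩ := z
    have hadj' : IncidenceAdj x z := hadj
    apply ih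
    -- The only edges leaving the pair go from `vtx t` to entries of `t`.
    rcases hxt with rfl | rfl
    · cases z with
      | elem a => exact absurd hzB (hno a hadj')
      | vtx _ => exact hadj'.elim
      | vtx' _ => exact Or.inr (congrArg _ (Eq.symm hadj'))
    · cases z with
      | elem a => exact hadj'.elim
      | vtx _ => exact Or.inl (congrArg _ hadj')
      | vtx' _ => exact hadj'.elim

/-- If a connected set of vertices of the incidence graph contains an element of the structure, then
for each vertex `x` of the set, the set contains an element equal to `x` or occurring in the tuple
of `x`. -/
theorem exists_touches_of_connected {B : Set (IncidenceVertex L M)}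
    (hB : ((incidenceGraph L M).graph.induce B).Connected) {a : M} (ha : .elem a ∈ B)
    {x : IncidenceVertex L M} (hx : x ∈ B) : ∃ b, .elem b ∈ B ∧ x.Touches b := by
  have key : ∀ t : RelTuple L M, (x = .vtx t ∨ x = .vtx' t) →
      ∃ b, .elem b ∈ B ∧ b ∈ Set.range t.entries := by
    intro t hxt
    by_contra! hno
    have := subset_pair_of_connected hB hx hxt (fun b hb hbB => hno b hbB hb) _ ha
    simp at this
  cases x with
  | elem b => exact ⟨b, hx, rfl⟩
  | vtx t => exact key t (Or.inl rfl)
  | vtx' t => exact key t (Or.inr rfl)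

/-- Every incidence edge belongs to a single tuple, and both `a` and `b` are entries of it. -/
theorem gaifmanGraph_adj_of_touches {x y : IncidenceVertex L M}
    (hxy : (incidenceGraph L M).graph.Adj x y) {a b : M} (ha : x.Touches a) (hb : y.Touches b)
    (hab : a ≠ b) : (gaifmanGraph L M).Adj a b := by
  have hxy' : IncidenceAdj x y := hxy
  cases x <;> cases y <;> try exact hxy'.elim
  · cases ha
    exact gaifmanGraph_adj_of_mem hxy' hb hab
  · cases hb
    exact gaifmanGraph_adj_of_mem ha hxy' hab
  · cases hxy'
    exact gaifmanGraph_adj_of_mem ha hb hab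
  · cases hxy'
    exact gaifmanGraph_adj_of_mem ha hb hab

/-- A minor of depth `r` of the incidence graph consists of a minor of depth `2 r` of the Gaifman
graph and of vertices of bounded degree. -/
theorem exists_induce_isMinorOfDepth_gaifmanGraph {W : Type*} {K r : ℕ}
    (hK : ∀ t : RelTuple L M, t.arity ≤ K) {H : SimpleGraph W}
    (hH : IsMinorOfDepth r H (incidenceGraph L M).graph) :
    ∃ A : Set W, IsMinorOfDepth (2 * r) (H.induce A) (gaifmanGraph L M) ∧
      ∀ w, w ∉ A → (H.neighborSet w).ncard ≤ K + 2 := by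
  obtain ⟨B, hdisj, hrad, hadj⟩ := hH
  have hconn := fun w => connected_of_radius_le (hrad w)
  refine ⟨{w | ∃ a, .elem a ∈ B w}, ⟨fun w => IncidenceVertex.elem ⁻¹' B w, ?_, ?_, ?_⟩, ?_⟩
  · intro w w' hne
    exact (hdisj w w' fun h => hne (Subtype.ext h)).preimage _
  · rintro ⟨w, a, ha⟩
    exact radius_induce_elem_le (hrad w) ha
  · rintro ⟨w, a, ha⟩ ⟨w', a', ha'⟩ hww
    have hww : H.Adj w w' := hww
    obtain ⟨x, hx, y, hy, hxy⟩ := hadj w w' hww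
    obtain ⟨b, hb, hxb⟩ := exists_touches_of_connected (hconn w) ha hx
    obtain ⟨b', hb', hyb⟩ := exists_touches_of_connected (hconn w') ha' hy
    refine ⟨b, hb, b', hb', gaifmanGraph_adj_of_touches hxy hxb hyb ?_⟩
    rintro rfl
    exact Set.disjoint_left.1 (hdisj w w' hww.ne) hb hb'
  · intro w hw
    have hw : ∀ a, .elem a ∉ B w := fun a ha => hw ⟨a, ha⟩
    obtain ⟨⟨x, hx⟩⟩ := (hconn w).nonempty
    obtain ⟨t, hxt⟩ : ∃ t : RelTuple L M, x = .vtx t ∨ x = .vtx' t := by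
      cases x with
      | elem a => exact absurd hx (hw a)
      | vtx t => exact ⟨t, Or.inl rfl⟩
      | vtx' t => exact ⟨t, Or.inr rfl⟩
    have hBw := subset_pair_of_connected (hconn w) hx hxt fun a _ => hw a
    -- `N` contains all neighbours of the pair. The pair itself is included because `B w` may be
    -- only one of its two vertices.
    let N : Set (IncidenceVertex L M) :=
      insert (.vtx t) (insert (.vtx' t) (Set.range fun i => .elem (t.entries i)))
    have hNfin : N.Finite := ((Set.finite_range _).insert _).insert _
    have hNcard : N.ncard ≤ K + 2 := by
      have h1 : (Set.range fun i => IncidenceVertex.elem (L := L) (t.entries i)).ncard ≤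
          t.arity := by
        rw [← Set.image_univ]
        refine (Set.ncard_image_le (Set.toFinite _)).trans ?_
        simp [Set.ncard_univ]
      have h2 := Set.ncard_insert_le (IncidenceVertex.vtx' t)
        (Set.range fun i => IncidenceVertex.elem (L := L) (t.entries i))
      have h3 : N.ncard ≤ _ := Set.ncard_insert_le (IncidenceVertex.vtx t)
        (insert (.vtx' t) (Set.range fun i => IncidenceVertex.elem (L := L) (t.entries i)))
      have := hK t
      omega
    have hmeet : ∀ w' ∈ H.neighborSet w, ∃ y ∈ N, y ∈ B w' := by
      intro w' hw'
      obtain ⟨x, hx, y, hy, hxy⟩ := hadj w w' hw'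
      refine ⟨y, ?_, hy⟩
      have hxy : IncidenceAdj x y := hxy
      rcases hBw x hx with rfl | rfl
      · cases y with
        | elem a =>
          obtain ⟨i, rfl⟩ := hxy
          exact Or.inr (Or.inr ⟨i, rfl⟩)
        | vtx _ => exact hxy.elim
        | vtx' _ => cases hxy; exact Or.inr (Or.inl rfl)
      · cases y with
        | elem a => exact hxy.elim
        | vtx _ => cases hxy; exact Or.inl rfl
        | vtx' _ => exact hxy.elim
    have : Nonempty (IncidenceVertex L M) := ⟨x⟩
    choose! f hfN hfB using hmeet
    refine (Set.ncard_le_ncard_of_injOn f hfN ?_ hNfin).trans hNcard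
    -- Disjointness of the branch sets makes the choice of a vertex of `N` in each neighbouring
    -- branch set injective.
    intro w₁ h₁ w₂ h₂ heq
    by_contra hne
    refine Set.disjoint_left.1 (hdisj w₁ w₂ hne) (hfB w₁ h₁) ?_
    rw [heq]
    exact hfB w₂ h₂

/-! ### Bounds on density and clique number -/

theorem nabla_incidenceGraph_le {K : ℕ} (hK : ∀ t : RelTuple L M, t.arity ≤ K) (r : ℕ) :
    nabla r (incidenceGraph L M).graph ≤ nabla (2 * r) (gaifmanGraph L M) + (K + 2 : ℕ) := by
  classical
  refine iSup_le fun n => iSup_le fun H => iSup_le fun hH => ?_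
  obtain ⟨A, hA, hdeg⟩ := exists_induce_isMinorOfDepth_gaifmanGraph hK hH
  have h1 : (H.edgeSet.ncard : ℝ≥0∞) ≤
      (H.induce A).edgeSet.ncard + (n : ℝ≥0∞) * (K + 2 : ℕ) := by
    have := ncard_edgeSet_le_induce_add H A (K + 2) hdeg
    rw [Fintype.card_fin] at this
    exact_mod_cast this
  have h2 : (Fintype.card A : ℝ≥0∞) ≤ n := by
    have := set_fintype_card_le_univ A
    rw [Fintype.card_fin] at this
    exact_mod_cast this
  refine ENNReal.div_le_of_le_mul (h1.trans ?_)
  rw [add_mul, mul_comm (n : ℝ≥0∞)]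
  gcongr
  exact hA.ncard_edgeSet_le.trans (by gcongr)

theorem cliqueNum_le_of_isMinorOfDepth_incidenceGraph {K k r n : ℕ}
    (hK : ∀ t : RelTuple L M, t.arity ≤ K)
    (hG : ∀ (n : ℕ) (H : SimpleGraph (Fin n)),
      IsMinorOfDepth (2 * r) H (gaifmanGraph L M) → H.cliqueNum ≤ k)
    {H : SimpleGraph (Fin n)} (hH : IsMinorOfDepth r H (incidenceGraph L M).graph) :
    H.cliqueNum ≤ k + (K + 3) := by
  classical
  obtain ⟨A, hA, hdeg⟩ := exists_induce_isMinorOfDepth_gaifmanGraph hK hH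
  obtain ⟨s, hs⟩ := H.exists_isNClique_cliqueNum
  rw [← hs.card_eq]
  -- A clique inside `A` has at most `k` vertices, any other at most `(K + 2) + 1`; the sum covers
  -- both cases.
  rcases isClique_subset_or_card_le hdeg hs.isClique with hsA | hcard
  · have hclique : (H.induce A).IsClique (s.subtype (· ∈ A) : Finset A) := by
      intro a ha b hb hab
      rw [Finset.mem_coe, Finset.mem_subtype] at ha hb
      exact hs.isClique ha hb fun h => hab (Subtype.ext h)
    have hle := hA.card_le_of_isClique hG hclique
    rw [Finset.card_subtype, Finset.filter_true_of_mem fun x hx => hsA hx] at hle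
    omega
  · omega

/-- Finiteness of the dictionary enters here: one arity bound serves all structures at once. -/
theorem exists_arity_le (L : FirstOrder.Language.{v, w}) [Finite L.Symbols] :
    ∃ K : ℕ, ∀ (M : Type u) [L.Structure M] (t : RelTuple L M), t.arity ≤ K := by
  have : Finite (Σ k, L.Relations k) := Finite.of_injective
    (Sum.inr : (Σ k, L.Relations k) → L.Symbols) Sum.inr_injective
  obtain ⟨K, hK⟩ := (Set.finite_range fun R : Σ k, L.Relations k => R.1).bddAbove
  exact ⟨K, fun M _ t => hK ⟨⟨t.arity, t.symbol⟩, rfl⟩⟩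

end Incidence

end SparseClasses

theorem mainTheorem11
    (σ : FirstOrder.Language.{v, w}) [σ.IsRelational] [Finite σ.Symbols]
    (𝒮 : Set (CategoryTheory.Bundled.{u} σ.Structure)) :
    (SparseClasses.StructuresHaveBoundedExpansion 𝒮 →
      (SparseClasses.incidenceClass 𝒮).HasBoundedExpansion) ∧
    (SparseClasses.StructuresAreNowhereDense 𝒮 →
      (SparseClasses.incidenceClass 𝒮).IsNowhereDense) := by
  obtain ⟨K, hK⟩ := SparseClasses.exists_arity_le.{u} σ
  constructor
  · rintro ⟨f, hf⟩
    refine ⟨fun r => f (2 * r) + (K + 2 : ℕ), ?_⟩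
    rintro _ ⟨_, ⟨S, hS, rfl⟩, rfl⟩ r
    refine (SparseClasses.nabla_incidenceGraph_le (hK S) r).trans ?_
    rw [ENNReal.coe_add, ENNReal.coe_natCast]
    gcongr
    exact hf _ ⟨S, hS, rfl⟩ (2 * r)
  · rintro ⟨f, hf⟩
    refine ⟨fun r => f (2 * r) + (K + 3), ?_⟩
    rintro _ ⟨_, ⟨S, hS, rfl⟩, rfl⟩ r n H hH
    exact SparseClasses.cliqueNum_le_of_isMinorOfDepth_incidenceGraph (hK S)
      (fun n H hH => hf _ ⟨S, hS, rfl⟩ (2 * r) n H hH) hH
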